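/- All Hilbert spaces are complex, $\hat\otimes_2$ is the Hilbertian tensor product and $(-)^\dagger$ the Hilbert adjoint. Let $(H,\mu)$ be a commutative Hilbertian Frobenius semigroup: $H$ is a Hilbert space and $\mu\colon H\hat\otimes_2 H\to H$ is a bounded linear map that is associative and commutative and satisfies the Frobenius condition $$(\mu\hat\otimes_2 \mathrm{id})\circ\alpha^{-1}\circ(\mathrm{id}\hat\otimes_2\mu^\dagger)=\mu^\dagger\circ\mu=(\mathrm{id}\hat\otimes_2\mu)\circ\alpha\circ(\mu^\dagger\hat\otimes_2 \mathrm{id}),$$ where $\alpha\colon (H\hat\otimes_2 H)\hat\otimes_2 H\to H\hat\otimes_2(H\hat\otimes_2 H)$ is the associativity constraint. Let $J=J(H,\mu)$ be the Jacobson radical of the algebra $H$ with product $uv=\mu(u\otimes v)$, that is, the intersection of all its maximal modular ideals, and let $G=G(H,\mu)=\{x\in H\setminus\{0\}\colon \mu^\dagger(x)=x\otimes x\}$ be the set of group-like elements. For a set $X$ and a map $w\colon X\to[C,+\infty[$ with $C>0$, let $\ell^2_w(X)$ be the Hilbert space of all $f\colon X\to\mathbb{C}$ with $\sum_{x\in X}w(x)|f(x)|^2<\infty$,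 with inner product $\langle f,g\rangle_w=\sum_{x\in X}w(x)f(x)\overline{g(x)}$, and let $\mu_X\colon \ell^2_w(X)\hat\otimes_2\ell^2_w(X)\to\ell^2_w(X)$ be the bounded linear map with $\mu_X(f\otimes g)=fg$ (pointwise product). Then: 1. $J^\perp$ is a closed subalgebra of $(H,\mu)$. 2. The map $w\colon G\to\,]0,+\infty[$, $w(x)=\frac{1}{\|x\|^2}$, takes its values in $\big[\frac{1}{\|\mu\|_{\mathrm{op}}^2},+\infty\big[$; in particular $\|\mu\|_{\mathrm{op}}>0$ whenever $G\neq\emptyset$. (If $G=\emptyset$, then $w$ is the empty map.) 3. With the multiplication restricted from $\mu$, $J^\perp$ is unitarily isomorphic as a semigroup to $(\ell^2_w(G),\mu_G)$: there is a unitary map $U\colon J^\perp\to\ell^2_w(G)$ with $U(uv)=U(u)\,U(v)$ for all $u,v\in J^\perp$. -/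

import Mathlib

open scoped TensorProduct ComplexConjugate

noncomputable section

namespace HilbFrob

/-! ### The Hilbertian tensor product -/

section Tensor

variable {H K L H' K' : Type*}
  [NormedAddCommGroup H] [InnerProductSpace ℂ H]
  [NormedAddCommGroup K] [InnerProductSpace ℂ K]
  [NormedAddCommGroup L] [InnerProductSpace ℂ L]
  [NormedAddCommGroup H'] [InnerProductSpace ℂ H']
  [NormedAddCommGroup K'] [InnerProductSpace ℂ K']

/-- The Hilbertian tensor product: the completion of the algebraic tensor product for the
inner product with `⟪x ⊗ y, x' ⊗ y'⟫ = ⟪x, x'⟫ * ⟪y, y'⟫`. -/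
def HTensor (H K : Type*) [NormedAddCommGroup H] [InnerProductSpace ℂ H]
    [NormedAddCommGroup K] [InnerProductSpace ℂ K] : Type _ :=
  UniformSpace.Completion (H ⊗[ℂ] K)

instance : NormedAddCommGroup (HTensor H K) :=
  inferInstanceAs (NormedAddCommGroup (UniformSpace.Completion (H ⊗[ℂ] K)))
instance : InnerProductSpace ℂ (HTensor H K) :=
  inferInstanceAs (InnerProductSpace ℂ (UniformSpace.Completion (H ⊗[ℂ] K)))
instance : CompleteSpace (HTensor H K) :=
  inferInstanceAs (CompleteSpace (UniformSpace.Completion (H ⊗[ℂ] K)))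

/-- The inclusion of the algebraic tensor product. -/
def incl (H K : Type*) [NormedAddCommGroup H] [InnerProductSpace ℂ H]
    [NormedAddCommGroup K] [InnerProductSpace ℂ K] : H ⊗[ℂ] K →ₗᵢ[ℂ] HTensor H K :=
  (UniformSpace.Completion.toComplₗᵢ : H ⊗[ℂ] K →ₗᵢ[ℂ] UniformSpace.Completion (H ⊗[ℂ] K))

theorem denseRange_incl : DenseRange (incl H K) :=
  UniformSpace.Completion.denseRange_coe (α := H ⊗[ℂ] K)

/-- The elementary tensor `x ⊗ y`. -/
def tmul (x : H) (y : K) : HTensor H K := incl H K (x ⊗ₜ[ℂ] y)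

/-- The extension by continuity of a bounded linear map on the algebraic tensor product. -/
def tlift [CompleteSpace L] (f : H ⊗[ℂ] K →L[ℂ] L) : HTensor H K →L[ℂ] L :=
  f.extend (incl H K).toContinuousLinearMap

theorem tlift_incl [CompleteSpace L] (f : H ⊗[ℂ] K →L[ℂ] L) (t : H ⊗[ℂ] K) :
    tlift f (incl H K t) = f t :=
  f.extend_eq (e := (incl H K).toContinuousLinearMap) denseRange_incl
    (incl H K).isometry.isUniformInducing t

/-- The map `f ⊗ g` on Hilbertian tensor products. -/
def tmap (f : H →L[ℂ] H') (g : K →L[ℂ] K') : HTensor H K →L[ℂ] HTensor H' K' :=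
  tlift ((incl H' K').toContinuousLinearMap ∘L TensorProduct.mapL f g)

theorem tmap_tmul (f : H →L[ℂ] H') (g : K →L[ℂ] K') (x : H) (y : K) :
    tmap f g (tmul x y) = tmul (f x) (g y) :=
  tlift_incl _ _

theorem inner_tmul (x x' : H) (y y' : K) :
    inner ℂ (tmul x y) (tmul x' y') = inner ℂ x x' * inner ℂ y y' := by
  simp [tmul]

/-- The symmetry `x ⊗ y ↦ y ⊗ x`. -/
def tcomm (H K : Type*) [NormedAddCommGroup H] [InnerProductSpace ℂ H]
    [NormedAddCommGroup K] [InnerProductSpace ℂ K] : HTensor H K →L[ℂ] HTensor K H :=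
  tlift ((incl K H).comp (TensorProduct.commIsometry ℂ H K).toLinearIsometry).toContinuousLinearMap

theorem tcomm_tmul (x : H) (y : K) : tcomm H K (tmul x y) = tmul y x :=
  tlift_incl _ _

/-- The canonical map from `(H ⊗ K) ⊗ L` to its iterated completion. -/
def assocEmbL (H K L : Type*) [NormedAddCommGroup H] [InnerProductSpace ℂ H]
    [NormedAddCommGroup K] [InnerProductSpace ℂ K]
    [NormedAddCommGroup L] [InnerProductSpace ℂ L] :
    (H ⊗[ℂ] K) ⊗[ℂ] L →ₗᵢ[ℂ] HTensor (HTensor H K) L :=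
  (incl (HTensor H K) L).comp (LinearIsometry.rTensor L (incl H K))

/-- The canonical map from `H ⊗ (K ⊗ L)` to its iterated completion. -/
def assocEmbR (H K L : Type*) [NormedAddCommGroup H] [InnerProductSpace ℂ H]
    [NormedAddCommGroup K] [InnerProductSpace ℂ K]
    [NormedAddCommGroup L] [InnerProductSpace ℂ L] :
    H ⊗[ℂ] (K ⊗[ℂ] L) →ₗᵢ[ℂ] HTensor H (HTensor K L) :=
  (incl H (HTensor K L)).comp (LinearIsometry.lTensor H (incl K L))

theorem denseRange_rTensor (L : Type*) [NormedAddCommGroup L] [InnerProductSpace ℂ L]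
    (f : H →ₗᵢ[ℂ] H') (hf : DenseRange f) : DenseRange (f.rTensor L) := by
  have key : ∀ t : H' ⊗[ℂ] L, t ∈ (LinearMap.range (f.rTensor L).toLinearMap).topologicalClosure := by
    intro t
    induction t with
    | zero => exact Submodule.zero_mem _
    | add a b ha hb => exact Submodule.add_mem _ ha hb
    | tmul a b =>
      refine hf.induction_on (p := fun a => a ⊗ₜ[ℂ] b ∈
        (LinearMap.range (f.rTensor L).toLinearMap).topologicalClosure) a ?_ ?_
      · refine IsClosed.preimage ?_ (Submodule.isClosed_topologicalClosure _)
        exact TensorProduct.continuous_tmul.comp (by fun_prop : Continuous fun a : H' => (a, b))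
      · intro x
        exact Submodule.le_topologicalClosure _ ⟨x ⊗ₜ b, rfl⟩
  intro t
  exact key t

theorem denseRange_lTensor (L : Type*) [NormedAddCommGroup L] [InnerProductSpace ℂ L]
    (f : H →ₗᵢ[ℂ] H') (hf : DenseRange f) : DenseRange (f.lTensor L) := by
  have key : ∀ t : L ⊗[ℂ] H', t ∈ (LinearMap.range (f.lTensor L).toLinearMap).topologicalClosure := by
    intro t
    induction t with
    | zero => exact Submodule.zero_mem _
    | add a b ha hb => exact Submodule.add_mem _ ha hb
    | tmul b a =>
      refine hf.induction_on (p := fun a => b ⊗ₜ[ℂ] a ∈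
        (LinearMap.range (f.lTensor L).toLinearMap).topologicalClosure) a ?_ ?_
      · refine IsClosed.preimage ?_ (Submodule.isClosed_topologicalClosure _)
        exact TensorProduct.continuous_tmul.comp (by fun_prop : Continuous fun a : H' => (b, a))
      · intro x
        exact Submodule.le_topologicalClosure _ ⟨b ⊗ₜ x, rfl⟩
  intro t
  exact key t

theorem denseRange_assocEmbL : DenseRange (assocEmbL H K L).toLinearMap :=
  denseRange_incl.comp (denseRange_rTensor L (incl H K) denseRange_incl) (incl _ _).continuous

theorem denseRange_assocEmbR : DenseRange (assocEmbR H K L).toLinearMap :=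
  denseRange_incl.comp (denseRange_lTensor H (incl K L) denseRange_incl) (incl _ _).continuous

/-- The unitary associativity constraint `(x ⊗ y) ⊗ z ↦ x ⊗ (y ⊗ z)`. -/
def tassoc (H K L : Type*) [NormedAddCommGroup H] [InnerProductSpace ℂ H]
    [NormedAddCommGroup K] [InnerProductSpace ℂ K]
    [NormedAddCommGroup L] [InnerProductSpace ℂ L] :
    HTensor (HTensor H K) L ≃ₗᵢ[ℂ] HTensor H (HTensor K L) :=
  LinearEquiv.extendOfIsometry (TensorProduct.assoc ℂ H K L)
    (assocEmbL H K L).toLinearMap (assocEmbR H K L).toLinearMap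
    denseRange_assocEmbL denseRange_assocEmbR (fun x => by
      rw [LinearIsometry.coe_toLinearMap, LinearIsometry.coe_toLinearMap,
        LinearIsometry.norm_map, LinearIsometry.norm_map, TensorProduct.norm_assoc])

theorem tassoc_tmul (x : H) (y : K) (z : L) :
    tassoc H K L (tmul (tmul x y) z) = tmul x (tmul y z) :=
  LinearEquiv.extendOfIsometry_eq (TensorProduct.assoc ℂ H K L)
    (assocEmbL H K L).toLinearMap (assocEmbR H K L).toLinearMap
    denseRange_assocEmbL denseRange_assocEmbR _ ((x ⊗ₜ[ℂ] y) ⊗ₜ[ℂ] z)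

end Tensor

/-! ### Hilbertian Frobenius semigroups -/

section Semigroup

variable {H K : Type*}
  [NormedAddCommGroup H] [InnerProductSpace ℂ H]
  [NormedAddCommGroup K] [InnerProductSpace ℂ K]

/-- `(H, μ)` is a Hilbertian algebra, that is, a commutative semigroup object in the symmetric
monoidal category of complex Hilbert spaces. -/
structure IsHilbertianAlgebra (μ : HTensor H H →L[ℂ] H) : Prop where
  assoc : μ ∘L tmap μ (ContinuousLinearMap.id ℂ H) =
    μ ∘L tmap (ContinuousLinearMap.id ℂ H) μ ∘L
      ((tassoc H H H).toContinuousLinearEquiv :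
        HTensor (HTensor H H) H →L[ℂ] HTensor H (HTensor H H))
  comm : μ ∘L tcomm H H = μ

/-- The comultiplication: the Hilbert adjoint of the multiplication. -/
def comul [CompleteSpace H] (μ : HTensor H H →L[ℂ] H) : H →L[ℂ] HTensor H H :=
  ContinuousLinearMap.adjoint μ

/-- The Frobenius condition: both cells of the Frobenius diagram commute. -/
structure IsFrobenius [CompleteSpace H] (μ : HTensor H H →L[ℂ] H) : Prop where
  left : comul μ ∘L μ =
    tmap μ (ContinuousLinearMap.id ℂ H) ∘L
      ((tassoc H H H).symm.toContinuousLinearEquiv :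
        HTensor H (HTensor H H) →L[ℂ] HTensor (HTensor H H) H) ∘L
      tmap (ContinuousLinearMap.id ℂ H) (comul μ)
  right : comul μ ∘L μ =
    tmap (ContinuousLinearMap.id ℂ H) μ ∘L
      ((tassoc H H H).toContinuousLinearEquiv :
        HTensor (HTensor H H) H →L[ℂ] HTensor H (HTensor H H)) ∘L
      tmap (comul μ) (ContinuousLinearMap.id ℂ H)

/-- `(H, μ)` is a (commutative) Hilbertian Frobenius semigroup. -/
structure IsHilbertianFrobenius [CompleteSpace H] (μ : HTensor H H →L[ℂ] H) : Prop
    extends IsHilbertianAlgebra μ, IsFrobenius μ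

/-- The group-like elements: the non-zero `x` with `μ† x = x ⊗ x`. -/
def groupLike [CompleteSpace H] (μ : HTensor H H →L[ℂ] H) : Set H :=
  {x | x ≠ 0 ∧ comul μ x = tmul x x}

/-- `I` is a left ideal of the algebra `H` with product `u v = μ (u ⊗ v)`. -/
def IsLeftIdeal (μ : HTensor H H →L[ℂ] H) (I : Submodule ℂ H) : Prop :=
  ∀ u : H, ∀ v ∈ I, μ (tmul u v) ∈ I

/-- `I` is modular: there is `e` with `u - u e ∈ I` for all `u`. -/
def IsModular (μ : HTensor H H →L[ℂ] H) (I : Submodule ℂ H) : Prop :=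
  ∃ e : H, ∀ u : H, u - μ (tmul u e) ∈ I

/-- `I` is a maximal modular left ideal: a modular left ideal that is maximal among the proper
left ideals. -/
def IsMaximalModularIdeal (μ : HTensor H H →L[ℂ] H) (I : Submodule ℂ H) : Prop :=
  IsModular μ I ∧ Maximal (fun I' : Submodule ℂ H => IsLeftIdeal μ I' ∧ I' ≠ ⊤) I

/-- The Jacobson radical: the intersection of all maximal modular left ideals (it is `H` if there
are none). -/
def jacobson (μ : HTensor H H →L[ℂ] H) : Submodule ℂ H :=
  sInf {I | IsMaximalModularIdeal μ I}

/-- `V` is a subalgebra of `(H, μ)`: a closed subspace such that `μ` maps `V ⊗ V` into `V`. -/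
def IsSubalgebra (μ : HTensor H H →L[ℂ] H) (V : Submodule ℂ H) : Prop :=
  IsClosed (V : Set H) ∧ ∀ t : HTensor V V, μ (tmap V.subtypeL V.subtypeL t) ∈ V

/-- The restriction and co-restriction of the multiplication to a subalgebra. -/
def restrict (μ : HTensor H H →L[ℂ] H) (V : Submodule ℂ H) (hV : IsSubalgebra μ V) :
    HTensor V V →L[ℂ] V :=
  (μ ∘L tmap V.subtypeL V.subtypeL).codRestrict V hV.2

/-- `f` is a morphism of semigroups from `(H, μ)` to `(K, γ)`. -/
def IsSemigroupHom (μ : HTensor H H →L[ℂ] H) (γ : HTensor K K →L[ℂ] K) (f : H →L[ℂ] K) : Prop :=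
  f ∘L μ = γ ∘L tmap f f

/-- `(H, μ)` and `(K, γ)` are unitarily isomorphic as semigroups. -/
def UnitarilyIsomorphic (μ : HTensor H H →L[ℂ] H) (γ : HTensor K K →L[ℂ] K) : Prop :=
  ∃ U : H ≃ₗᵢ[ℂ] K,
    IsSemigroupHom μ γ (U.toContinuousLinearEquiv : H →L[ℂ] K) ∧
    IsSemigroupHom γ μ (U.symm.toContinuousLinearEquiv : K →L[ℂ] H)

end Semigroup

/-! ### Weighted Hilbert spaces -/

/-- A weight on `X`: a map `w : X → [C, ∞)` for some `C > 0`. -/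
structure Weight (X : Type*) where
  /-- the underlying map -/
  toFun : X → ℝ
  bounded_below : ∃ C : ℝ, 0 < C ∧ ∀ x, C ≤ toFun x

instance {X : Type*} : CoeFun (Weight X) (fun _ => X → ℝ) := ⟨Weight.toFun⟩

section Weighted

variable {X : Type*}

theorem Weight.pos (w : Weight X) (x : X) : 0 < w x := by
  obtain ⟨C, hC, h⟩ := w.bounded_below
  exact hC.trans_le (h x)

/-- The functions `f : X → ℂ` with `∑ w(x) |f(x)|² < ∞`, as a subspace of all functions. -/
def weightedSubmodule (w : Weight X) : Submodule ℂ (X → ℂ) where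
  carrier := {f | Summable fun x => w x * ‖f x‖ ^ 2}
  zero_mem' := by simp [summable_zero]
  add_mem' {f g} hf hg := by
    refine Summable.of_nonneg_of_le (fun x => ?_) (fun x => ?_) ((hf.add hg).mul_left 2)
    · exact mul_nonneg (w.pos x).le (sq_nonneg _)
    · have h1 : ‖f x + g x‖ ^ 2 ≤ 2 * (‖f x‖ ^ 2 + ‖g x‖ ^ 2) := by
        nlinarith [norm_add_le (f x) (g x), norm_nonneg (f x + g x), sq_nonneg (‖f x‖ - ‖g x‖),
          norm_nonneg (f x), norm_nonneg (g x)]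
      have := mul_le_mul_of_nonneg_left h1 (w.pos x).le
      simp only [Pi.add_apply]
      linarith
  smul_mem' c f hf := by
    have : (fun x => w x * ‖(c • f) x‖ ^ 2) = fun x => ‖c‖ ^ 2 * (w x * ‖f x‖ ^ 2) := by
      funext x
      simp only [Pi.smul_apply, smul_eq_mul, norm_mul]
      ring
    change Summable fun x => w x * ‖(c • f) x‖ ^ 2
    rw [this]
    exact Summable.mul_left _ hf

/-- The weighted space `ℓ²_w(X)`. -/
def WL2 (w : Weight X) : Type _ := weightedSubmodule w

namespace WL2

variable {w : Weight X}

instance : AddCommGroup (WL2 w) := inferInstanceAs (AddCommGroup (weightedSubmodule w))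
instance : Module ℂ (WL2 w) := inferInstanceAs (Module ℂ (weightedSubmodule w))
/-- The function underlying an element of `ℓ²_w(X)`. -/
def toFun (f : WL2 w) : X → ℂ := (show weightedSubmodule w from f).1

instance : CoeFun (WL2 w) (fun _ => X → ℂ) := ⟨toFun⟩

/-- The element of `ℓ²_w(X)` given by a function with `∑ w(x) |f(x)|² < ∞`. -/
def mk (f : X → ℂ) (hf : Summable fun x => w x * ‖f x‖ ^ 2) : WL2 w := ⟨f, hf⟩

@[simp] theorem mk_apply (f : X → ℂ) (hf : Summable fun x => w x * ‖f x‖ ^ 2) (x : X) :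
    (mk f hf : WL2 w) x = f x := rfl
@[simp] theorem add_apply (f g : WL2 w) (x : X) : (f + g) x = f x + g x := rfl
@[simp] theorem smul_apply (c : ℂ) (f : WL2 w) (x : X) : (c • f) x = c * f x := rfl
@[simp] theorem zero_apply (x : X) : (0 : WL2 w) x = 0 := rfl

@[ext] theorem ext {f g : WL2 w} (h : ∀ x, f x = g x) : f = g := Subtype.ext (funext h)

theorem summable (f : WL2 w) : Summable fun x => w x * ‖f x‖ ^ 2 := f.2

theorem summable_inner (f g : WL2 w) :
    Summable fun x => (w x : ℂ) * (conj (f x) * g x) := by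
  refine Summable.of_norm_bounded (f.summable.add g.summable) (fun x => ?_)
  rw [norm_mul, norm_mul, RCLike.norm_conj, Complex.norm_real, Real.norm_of_nonneg (w.pos x).le,
    ← mul_add]
  refine mul_le_mul_of_nonneg_left ?_ (w.pos x).le
  nlinarith [sq_nonneg (‖f x‖ - ‖g x‖), norm_nonneg (f x), norm_nonneg (g x)]

/-- The inner product `∑ w(x) conj(f(x)) g(x)` of `ℓ²_w(X)`, conjugate-linear in the first
variable. -/
def ip (f g : WL2 w) : ℂ := ∑' x, (w x : ℂ) * (conj (f x) * g x)

theorem ip_self (f : WL2 w) : ip f f = ((∑' x, w x * ‖f x‖ ^ 2 : ℝ) : ℂ) := by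
  rw [ip, Complex.ofReal_tsum]
  refine tsum_congr (fun x => ?_)
  rw [Complex.conj_mul']
  push_cast
  rfl

/-- The inner product space axioms for `ℓ²_w(X)`. -/
@[reducible] def core (w : Weight X) : InnerProductSpace.Core ℂ (WL2 w) where
  inner := ip
  conj_inner_symm f g := by
    rw [ip, ip, Complex.conj_tsum]
    refine tsum_congr (fun x => ?_)
    simp only [map_mul, Complex.conj_ofReal, Complex.conj_conj]
    ring
  re_inner_nonneg f := by
    rw [ip_self]
    exact tsum_nonneg fun x => mul_nonneg (w.pos x).le (sq_nonneg _)
  add_left f g h := by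
    rw [ip, ip, ip, ← (summable_inner f h).tsum_add (summable_inner g h)]
    refine tsum_congr (fun x => ?_)
    simp only [add_apply, map_add]
    ring
  smul_left f g c := by
    rw [ip, ip, ← tsum_mul_left]
    refine tsum_congr (fun x => ?_)
    simp only [smul_apply, map_mul]
    ring
  definite f hf := by
    rw [ip_self, Complex.ofReal_eq_zero] at hf
    have h0 := (hasSum_zero_iff_of_nonneg
      (fun x => mul_nonneg (w.pos x).le (sq_nonneg _))).1 (hf ▸ f.summable.hasSum)
    ext x
    have := congrFun h0 x
    simpa [(w.pos x).ne'] using this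

instance : NormedAddCommGroup (WL2 w) := (core w).toNormedAddCommGroup
instance : InnerProductSpace ℂ (WL2 w) := InnerProductSpace.ofCore (core w).toCore

theorem inner_def (f g : WL2 w) :
    inner ℂ f g = ∑' x, (w x : ℂ) * (conj (f x) * g x) := rfl

theorem norm_sq_eq (f : WL2 w) : ‖f‖ ^ 2 = ∑' x, w x * ‖f x‖ ^ 2 := by
  have h := inner_self_eq_norm_sq_to_K (𝕜 := ℂ) f
  rw [show inner ℂ f f = _ from ip_self f] at h
  exact Complex.ofReal_injective ((Complex.ofReal_pow _ _).trans h.symm)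

/-- The unitary map `f ↦ w^{1/2} f` onto the unweighted space `ℓ²(X)`. -/
def toLp (w : Weight X) : WL2 w ≃ₗᵢ[ℂ] lp (fun _ : X => ℂ) 2 where
  toFun f := ⟨fun x => (Real.sqrt (w x) : ℂ) * f x, by
    refine memℓp_gen ?_
    refine f.summable.congr (fun x => ?_)
    simp only [ENNReal.toReal_ofNat, Real.rpow_two, norm_mul, Complex.norm_real, mul_pow,
      Real.norm_eq_abs, sq_abs, Real.sq_sqrt (w.pos x).le]⟩
  map_add' f g := by
    ext x
    exact mul_add _ _ _
  map_smul' c f := by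
    ext x
    exact mul_left_comm _ _ _
  invFun g := mk (fun x => (Real.sqrt (w x) : ℂ)⁻¹ * g x) (by
    have := (lp.memℓp g).summable (by norm_num)
    refine this.congr (fun x => ?_)
    have hw := w.pos x
    simp only [ENNReal.toReal_ofNat, Real.rpow_two, norm_mul, norm_inv, Complex.norm_real, mul_pow,
      Real.norm_eq_abs, inv_pow, sq_abs, Real.sq_sqrt hw.le]
    field_simp)
  left_inv f := by
    ext x
    have : (Real.sqrt (w x) : ℂ) ≠ 0 := by
      exact_mod_cast (Real.sqrt_pos.2 (w.pos x)).ne'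
    exact inv_mul_cancel_left₀ this _
  right_inv g := by
    ext x
    have : (Real.sqrt (w x) : ℂ) ≠ 0 := by
      exact_mod_cast (Real.sqrt_pos.2 (w.pos x)).ne'
    exact mul_inv_cancel_left₀ this _
  norm_map' f := by
    refine (sq_eq_sq₀ (norm_nonneg _) (norm_nonneg _)).1 ?_
    have key : ∀ g : lp (fun _ : X => ℂ) 2, ‖g‖ ^ 2 = ∑' x, ‖g x‖ ^ 2 := fun g => by
      simpa using lp.norm_rpow_eq_tsum (p := 2) (by norm_num) g
    rw [norm_sq_eq]
    refine (key _).trans (tsum_congr (fun x => ?_))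
    change ‖(Real.sqrt (w x) : ℂ) * f x‖ ^ 2 = _
    simp only [norm_mul, Complex.norm_real, mul_pow, Real.norm_eq_abs, sq_abs,
      Real.sq_sqrt (w.pos x).le]

instance : CompleteSpace (WL2 w) :=
  (completeSpace_congr (e := (toLp w).toEquiv) (toLp w).isometry.isUniformEmbedding).2
    inferInstance

theorem norm_apply_sq_le (f : WL2 w) (x : X) : w x * ‖f x‖ ^ 2 ≤ ‖f‖ ^ 2 := by
  rw [norm_sq_eq]
  exact f.summable.le_tsum x (fun y _ => mul_nonneg (w.pos y).le (sq_nonneg _))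

theorem summable_mul (f g : WL2 w) : Summable fun x => w x * ‖f x * g x‖ ^ 2 := by
  obtain ⟨C, hC, hw⟩ := w.bounded_below
  refine Summable.of_nonneg_of_le (fun x => mul_nonneg (w.pos x).le (sq_nonneg _)) (fun x => ?_)
    (f.summable.mul_right (‖g‖ ^ 2 / C))
  have h1 : ‖g x‖ ^ 2 ≤ ‖g‖ ^ 2 / C := by
    rw [le_div_iff₀ hC]
    nlinarith [norm_apply_sq_le g x, hw x, sq_nonneg ‖g x‖]
  rw [norm_mul, mul_pow, ← mul_assoc]
  exact mul_le_mul_of_nonneg_left h1 (mul_nonneg (w.pos x).le (sq_nonneg _))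

/-- Pointwise multiplication on `ℓ²_w(X)` as a bilinear map. -/
def mulBilin (w : Weight X) : WL2 w →ₗ[ℂ] WL2 w →ₗ[ℂ] WL2 w :=
  LinearMap.mk₂ ℂ (fun f g => mk (fun x => f x * g x) (summable_mul f g))
    (fun f f' g => by ext x; exact add_mul _ _ _)
    (fun c f g => by ext x; exact mul_assoc _ _ _)
    (fun f g g' => by ext x; exact mul_add _ _ _)
    (fun c f g => by ext x; exact mul_left_comm _ _ _)

/-- The linear map `f ⊗ g ↦ f g` on the algebraic tensor product. -/
def mulAlg (w : Weight X) : WL2 w ⊗[ℂ] WL2 w →ₗ[ℂ] WL2 w := TensorProduct.lift (mulBilin w)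

open scoped Classical in
/-- The unit vector `δ_x / w(x)^{1/2}`. -/
def unitVec (w : Weight X) (x : X) : WL2 w :=
  mk (Pi.single x ((Real.sqrt (w x) : ℂ)⁻¹)) (by
    refine summable_of_ne_finset_zero (s := {x}) (fun y hy => ?_)
    rw [Pi.single_eq_of_ne (by simpa using hy)]
    simp)

open scoped Classical in
theorem inner_unitVec (x : X) (f : WL2 w) :
    inner ℂ (unitVec w x) f = (Real.sqrt (w x) : ℂ) * f x := by
  have hw : (Real.sqrt (w x) : ℂ) ≠ 0 := by
    exact_mod_cast (Real.sqrt_pos.2 (w.pos x)).ne'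
  have hw2 : (w x : ℂ) = (Real.sqrt (w x) : ℂ) * (Real.sqrt (w x) : ℂ) := by
    exact_mod_cast (Real.mul_self_sqrt (w.pos x).le).symm
  rw [inner_def, tsum_eq_single x]
  · simp only [unitVec, mk_apply, Pi.single_eq_same, map_inv₀, Complex.conj_ofReal]
    rw [hw2]
    field_simp
  · intro y hy
    simp [unitVec, Pi.single_eq_of_ne hy]

theorem orthonormal_unitVec (w : Weight X) : Orthonormal ℂ (unitVec w) := by
  classical
  rw [orthonormal_iff_ite]
  intro x y
  have hw : (Real.sqrt (w x) : ℂ) ≠ 0 := by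
    exact_mod_cast (Real.sqrt_pos.2 (w.pos x)).ne'
  rw [inner_unitVec]
  by_cases h : x = y
  · subst h
    simp [unitVec, hw]
  · simp [unitVec, h]

theorem orthonormal_unitVec_tmul (w : Weight X) :
    Orthonormal ℂ (fun x => unitVec w x ⊗ₜ[ℂ] unitVec w x) := by
  classical
  have h := orthonormal_iff_ite.1 (orthonormal_unitVec w)
  rw [orthonormal_iff_ite]
  intro x y
  rw [TensorProduct.inner_tmul, h]
  split_ifs <;> simp

theorem inner_unitVec_tmul (x : X) (t : WL2 w ⊗[ℂ] WL2 w) :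
    inner ℂ (unitVec w x ⊗ₜ[ℂ] unitVec w x) t = (w x : ℂ) * mulAlg w t x := by
  have hw2 : (w x : ℂ) = (Real.sqrt (w x) : ℂ) * (Real.sqrt (w x) : ℂ) := by
    exact_mod_cast (Real.mul_self_sqrt (w.pos x).le).symm
  induction t with
  | zero => simp
  | add a b ha hb => rw [inner_add_right, ha, hb, map_add, add_apply, mul_add]
  | tmul f g =>
    rw [TensorProduct.inner_tmul, inner_unitVec, inner_unitVec, hw2]
    change _ = _ * (f x * g x)
    ring

theorem exists_bound_mulAlg (w : Weight X) : ∃ M : ℝ, ∀ t, ‖mulAlg w t‖ ≤ M * ‖t‖ := by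
  obtain ⟨C, hC, hw⟩ := w.bounded_below
  refine ⟨Real.sqrt (1 / C), fun t => ?_⟩
  refine (sq_le_sq₀ (norm_nonneg _) (by positivity)).1 ?_
  rw [mul_pow, Real.sq_sqrt (by positivity), norm_sq_eq]
  have hb := (orthonormal_unitVec_tmul w).tsum_inner_products_le (x := t)
  have hs := (orthonormal_unitVec_tmul w).inner_products_summable (x := t)
  refine le_trans ?_ (mul_le_mul_of_nonneg_left hb (by positivity))
  rw [← tsum_mul_left]
  refine (mulAlg w t).summable.tsum_le_tsum (fun x => ?_) (hs.mul_left _)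
  rw [inner_unitVec_tmul, norm_mul, mul_pow, Complex.norm_real, Real.norm_eq_abs, sq_abs,
    ← mul_assoc]
  refine mul_le_mul_of_nonneg_right ?_ (sq_nonneg _)
  rw [div_mul_eq_mul_div, one_mul, le_div_iff₀ hC]
  nlinarith [hw x, w.pos x]

/-- The bounded linear multiplication of `ℓ²_w(X)`, with `f ⊗ g ↦ f g` (pointwise product). -/
def mul (w : Weight X) : HTensor (WL2 w) (WL2 w) →L[ℂ] WL2 w :=
  tlift ((mulAlg w).mkContinuousOfExistsBound (exists_bound_mulAlg w))

theorem mul_tmul (f g : WL2 w) (x : X) : mul w (tmul f g) x = f x * g x := by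
  rw [mul, tmul, tlift_incl]
  rfl

end WL2

end Weighted

end HilbFrob
end

/-!
By the Frobenius condition, applying the adjoint `M_u†` of the multiplication operator `M_u` to a
product only changes one of its factors. Hence `M_u†` commutes with every `M_v`; in particular `M_u`
is normal. Moreover `M_v† M_v` is the square of the conjugate-linear operator `u ↦ M_u† v`, the
contraction of the tensor `μ† v`. This contraction is a norm limit of finite-rank operators, since
algebraic tensors are dense, so `M_v† M_v` is compact.

A vector is group-like if and only if it represents a character of the algebra through the inner
product. By normality it is then an eigenvector of every `M_u`, so distinct group-like vectors are
orthogonal, and the orthogonal complement `K` of their span is invariant under all `M_u` and `M_u†`.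
If some `M_v` did not vanish on `K`, then `M_v† M_v` would have a nonzero finite-dimensional
eigenspace in `K` for a nonzero eigenvalue, hence `K` would contain a joint eigenvector of all `M_u`
with a nonzero character. But the group-like vector representing this character is not orthogonal
to the eigenvector. So `K` annihilates the algebra, which forces `J = K`. The group-like vectors
form an orthogonal basis of `J^⊥`, and the coefficient of `u` at `x` is the value at `u` of the
character `x`, which is multiplicative in `u`.
-/

open ContinuousLinearMap (adjoint)

noncomputable section

namespace HilbFrob

section Tensor

variable {H K L : Type*}
  [NormedAddCommGroup H] [InnerProductSpace ℂ H]
  [NormedAddCommGroup K] [InnerProductSpace ℂ K]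
  [NormedAddCommGroup L] [InnerProductSpace ℂ L]

theorem norm_tmul (x : H) (y : K) : ‖tmul x y‖ = ‖x‖ * ‖y‖ := by
  simp [tmul]

theorem mem_of_forall_tmul_mem {V : Submodule ℂ (HTensor H K)}
    (hV : IsClosed (V : Set (HTensor H K))) (h : ∀ x y, tmul x y ∈ V) (t : HTensor H K) :
    t ∈ V := by
  refine denseRange_incl.induction_on (p := fun t => t ∈ V) t hV fun a => ?_
  induction a with
  | zero => simp only [map_zero, V.zero_mem]
  | add a b ha hb => simpa only [map_add] using V.add_mem ha hb
  | tmul x y => exact h x y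

theorem ext_tmul {f g : HTensor H K →L[ℂ] L} (h : ∀ x y, f (tmul x y) = g (tmul x y)) :
    f = g :=
  ContinuousLinearMap.ext fun t =>
    mem_of_forall_tmul_mem (V := LinearMap.eqLocus f.toLinearMap g.toLinearMap)
      (isClosed_eq f.continuous g.continuous) h t

/-- The bounded bilinear map `(x, y) ↦ x ⊗ y` into the Hilbertian tensor product. -/
def tmulL (H K : Type*) [NormedAddCommGroup H] [InnerProductSpace ℂ H]
    [NormedAddCommGroup K] [InnerProductSpace ℂ K] : H →L[ℂ] K →L[ℂ] HTensor H K :=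
  (incl H K).toContinuousLinearMap.postcomp K ∘L TensorProduct.mkL ℂ H K

theorem tmulL_apply (x : H) (y : K) : tmulL H K x y = tmul x y := rfl

variable [CompleteSpace K]

/-- The conjugate-linear operator `x ↦ (⟨x| ⊗ id) t` from `H` to `K` attached to a tensor
`t : H ⊗ K`, where `⟨x| ⊗ id` is encoded as the adjoint of `y ↦ x ⊗ y`. -/
def contraction (H K : Type*) [NormedAddCommGroup H] [InnerProductSpace ℂ H]
    [NormedAddCommGroup K] [InnerProductSpace ℂ K] [CompleteSpace K] :
    HTensor H K →L[ℂ] H →L⋆[ℂ] K :=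
  ((adjoint : (K →L[ℂ] HTensor H K) ≃ₗᵢ⋆[ℂ] HTensor H K →L[ℂ] K).toContinuousLinearEquiv
    |>.toContinuousLinearMap.comp (tmulL H K)).flip

theorem contraction_apply (t : HTensor H K) (x : H) :
    contraction H K t x = adjoint (tmulL H K x) t := rfl

theorem contraction_tmul (a x : H) (b : K) :
    contraction H K (tmul a b) x = inner ℂ x a • b :=
  ext_inner_left ℂ fun y => by
    rw [contraction_apply, ContinuousLinearMap.adjoint_inner_right, tmulL_apply, inner_tmul,
      inner_smul_right]

theorem isCompactOperator_contraction_tmul (a : H) (b : K) :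
    IsCompactOperator (contraction H K (tmul a b)) := by
  have h : IsCompactOperator (fun c : ℂ => c • b) :=
    isCompactOperator_of_locallyCompactSpace_rng (ContinuousLinearMap.toSpanSingleton ℂ b)
  have e : ⇑(contraction H K (tmul a b)) = (fun c : ℂ => c • b) ∘
      ((starL ℂ : ℂ ≃L⋆[ℂ] ℂ).toContinuousLinearMap.comp (innerSL ℂ a)) :=
    funext fun x => by simp [contraction_tmul]
  exact e ▸ h.comp_clm _

theorem isCompactOperator_contraction (t : HTensor H K) :
    IsCompactOperator (contraction H K t) :=
  mem_of_forall_tmul_mem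
    (V := (compactOperator (starRingEnd ℂ) H K).comap (contraction H K).toLinearMap)
    (isClosed_setOfPred_isCompactOperator.preimage (contraction H K).continuous)
    isCompactOperator_contraction_tmul t

end Tensor

section LinearAlgebra

theorem exists_joint_eigenvector {ι 𝕜 V : Type*} [Field 𝕜] [IsAlgClosed 𝕜] [AddCommGroup V]
    [Module 𝕜 V] {T : ι → Module.End 𝕜 V} (hT : ∀ i j, Commute (T i) (T j))
    {F : Submodule 𝕜 V} [FiniteDimensional 𝕜 F] (hF : F ≠ ⊥)
    (hinv : ∀ i, F ∈ (T i).invtSubmodule) :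
    ∃ x ∈ F, x ≠ 0 ∧ ∀ i, ∃ c : 𝕜, T i x = c • x := by
  induction h : Module.finrank 𝕜 F using Nat.strong_induction_on generalizing F with
  | _ n ih =>
  by_cases hscalar : ∀ x ∈ F, ∀ i, ∃ c : 𝕜, T i x = c • x
  · obtain ⟨x, hxF, hx⟩ := F.ne_bot_iff.1 hF
    exact ⟨x, hxF, hx, hscalar x hxF⟩
  push Not at hscalar
  obtain ⟨x, hxF, i, hxi⟩ := hscalar
  have : Nontrivial F := Submodule.nontrivial_iff_ne_bot.2 hF
  obtain ⟨c, hc⟩ := Module.End.exists_eigenvalue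
    ((T i).restrict ((Module.End.mem_invtSubmodule _).1 (hinv i)))
  obtain ⟨e, he⟩ := hc.exists_hasEigenvector
  let F' : Submodule 𝕜 V := F ⊓ (T i).eigenspace c
  have hlt : F' < F := lt_of_le_of_ne inf_le_left fun hEq =>
    hxi c (Module.End.mem_eigenspace_iff.1 (hEq.ge hxF).2)
  have hF' : F' ≠ ⊥ := F'.ne_bot_iff.2
    ⟨e, ⟨e.2, Module.End.mem_eigenspace_iff.2 (congrArg Subtype.val he.apply_eq_smul)⟩,
      Subtype.coe_ne_coe.2 he.2⟩
  have hinv' : ∀ j, F' ∈ (T j).invtSubmodule := fun j =>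
    Module.End.invtSubmodule.inf_mem (hinv j)
      (Module.End.mapsTo_genEigenspace_of_comm (hT i j) c 1)
  have : FiniteDimensional 𝕜 F' := Submodule.finiteDimensional_of_le hlt.le
  obtain ⟨y, hy, hy0, hy'⟩ := ih _ (h ▸ Submodule.finrank_lt_finrank_of_lt hlt) hF' hinv' rfl
  exact ⟨y, hy.1, hy0, hy'⟩

theorem span_mem_invtSubmodule_of_forall_eq_smul {R M : Type*} [Semiring R] [AddCommMonoid M]
    [Module R M] {T : Module.End R M} {s : Set M} (h : ∀ x ∈ s, ∃ c : R, T x = c • x) :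
    Submodule.span R s ∈ T.invtSubmodule :=
  Submodule.span_le.2 fun x hx => by
    obtain ⟨c, hc⟩ := h x hx
    exact Submodule.mem_comap.2 (hc ▸ Submodule.smul_mem _ c (Submodule.subset_span hx))

variable {𝕜 E : Type*} [RCLike 𝕜] [NormedAddCommGroup E] [InnerProductSpace 𝕜 E]

theorem mem_orthogonal_span_iff {s : Set E} {u : E} :
    u ∈ (Submodule.span 𝕜 s)ᗮ ↔ ∀ x ∈ s, inner 𝕜 x u = 0 := by
  rw [← Submodule.span_singleton_le_iff_mem, ← Submodule.isOrtho_iff_le,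
    Submodule.isOrtho_comm, Submodule.isOrtho_span]
  simp only [Set.mem_singleton_iff, forall_eq]

theorem exists_eigenspace_inf_ne_bot {S : E →L[𝕜] E} (hS : IsCompactOperator S)
    (hS' : S.IsSymmetric) {K : Submodule 𝕜 E} [CompleteSpace K]
    (hK : K ∈ Module.End.invtSubmodule S.toLinearMap) {u : E} (hu : u ∈ K) (hSu : S u ≠ 0) :
    ∃ c ≠ 0, Module.End.eigenspace S.toLinearMap c ⊓ K ≠ ⊥ := by
  rw [Module.End.mem_invtSubmodule_iff_forall_mem_of_mem] at hK
  let S' : K →L[𝕜] K := S.restrict hK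
  have hcompact : IsCompactOperator S' := hS.restrict' (f := S.toLinearMap) hK
  have hsymm : S'.IsSymmetric := hS'.restrict_invariant hK
  have hS'0 : S' ≠ 0 := fun h => hSu <|
    congrArg Subtype.val (DFunLike.congr_fun h (⟨u, hu⟩ : K))
  rw [Ne, ← ContinuousLinearMap.eq_zero_of_forall_hasEigenvalue_eq_zero hcompact hsymm] at hS'0
  push Not at hS'0
  obtain ⟨c, hc, hc0⟩ := hS'0
  obtain ⟨e, he⟩ := hc.exists_hasEigenvector
  exact ⟨c, hc0, (Submodule.ne_bot_iff _).2
    ⟨e, ⟨Module.End.mem_eigenspace_iff.2 (congrArg Subtype.val he.apply_eq_smul), e.2⟩,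
      Subtype.coe_ne_coe.2 he.2⟩⟩

theorem exists_joint_eigenvector_of_isCompactOperator [IsAlgClosed 𝕜] [CompleteSpace E]
    {ι : Type*} {S : E →L[𝕜] E} (hS : IsCompactOperator S) (hS' : S.IsSymmetric)
    {T : ι → Module.End 𝕜 E}
    (hST : ∀ i, Commute S.toLinearMap (T i)) (hT : ∀ i j, Commute (T i) (T j))
    {K : Submodule 𝕜 E} [CompleteSpace K] (hSK : K ∈ Module.End.invtSubmodule S.toLinearMap)
    (hTK : ∀ i, K ∈ (T i).invtSubmodule) {u : E} (hu : u ∈ K) (hSu : S u ≠ 0) :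
    ∃ x ∈ K, S x ≠ 0 ∧ ∀ i, ∃ c : 𝕜, T i x = c • x := by
  obtain ⟨c, hc, hcK⟩ := exists_eigenspace_inf_ne_bot hS hS' hSK hu hSu
  have := ContinuousLinearMap.finite_dimensional_eigenspace hS c hc
  obtain ⟨x, ⟨hxc, hxK⟩, hx, hχ⟩ := exists_joint_eigenvector hT hcK fun i =>
    Module.End.invtSubmodule.inf_mem (Module.End.mapsTo_genEigenspace_of_comm (hST i) c 1) (hTK i)
  have hSx : S x = c • x := Module.End.mem_eigenspace_iff.1 hxc
  exact ⟨x, hxK, hSx ▸ smul_ne_zero hc hx, hχ⟩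

theorem orthonormal_inv_norm_smul {X : Type*} {b : X → E} (hb : ∀ x, b x ≠ 0)
    (horth : Pairwise fun x y => inner 𝕜 (b x) (b y) = 0) :
    Orthonormal 𝕜 fun x => (‖b x‖⁻¹ : 𝕜) • b x :=
  ⟨fun x => norm_smul_inv_norm (hb x), fun x y hxy => by
    simp only [inner_smul_left, inner_smul_right, horth hxy, mul_zero]⟩

theorem orthogonal_span_range_inv_norm_smul {X : Type*} {b : X → E} (hb : ∀ x, b x ≠ 0) :
    (Submodule.span 𝕜 (Set.range fun x => (‖b x‖⁻¹ : 𝕜) • b x))ᗮ =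
      (Submodule.span 𝕜 (Set.range b))ᗮ := by
  ext u
  simp [mem_orthogonal_span_iff, inner_smul_left, hb]

theorem apply_eq_conj_smul_of_adjoint_apply_eq_smul [CompleteSpace E] {T : E →L[𝕜] E}
    (hT : IsStarNormal T) {c : 𝕜} {x : E} (h : adjoint T x = c • x) : T x = conj c • x := by
  have hnormal : IsStarNormal (T - conj c • 1) := ⟨by
    rw [star_sub, star_smul, star_one]
    exact (hT.star_comm_self.sub_right ((Commute.one_right _).smul_right _)).sub_left
      ((Commute.one_left _).smul_left _)⟩
  have hadjoint : adjoint (T - conj c • 1) x = 0 := by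
    rw [← ContinuousLinearMap.star_eq_adjoint] at h ⊢
    simp [h]
  simpa [sub_eq_zero] using
    (ContinuousLinearMap.IsStarNormal.adjoint_apply_eq_zero_iff hnormal x).1 hadjoint

end LinearAlgebra

section Multiplication

variable {H : Type*} [NormedAddCommGroup H] [InnerProductSpace ℂ H] {μ : HTensor H H →L[ℂ] H}

/-- The product of the algebra `(H, μ)` in curried form; `mulL μ u` is the operator of
multiplication by `u`. -/
def mulL (μ : HTensor H H →L[ℂ] H) : H →L[ℂ] H →L[ℂ] H := μ.postcomp H ∘L tmulL H H

theorem mulL_apply (u v : H) : mulL μ u v = μ (tmul u v) := rfl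

theorem IsHilbertianAlgebra.mulL_comm (hμ : IsHilbertianAlgebra μ) (u v : H) :
    mulL μ u v = mulL μ v u := by
  simpa only [ContinuousLinearMap.comp_apply, tcomm_tmul, mulL_apply] using
    (DFunLike.congr_fun hμ.comm (tmul u v)).symm

theorem IsHilbertianAlgebra.mulL_mul (hμ : IsHilbertianAlgebra μ) (u v w : H) :
    mulL μ (mulL μ u v) w = mulL μ u (mulL μ v w) := by
  simpa [tmap_tmul, tassoc_tmul, mulL_apply] using
    DFunLike.congr_fun hμ.assoc (tmul (tmul u v) w)

theorem IsHilbertianAlgebra.mulL_mulL_comm (hμ : IsHilbertianAlgebra μ) (u v w : H) :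
    mulL μ u (mulL μ v w) = mulL μ v (mulL μ u w) := by
  rw [← hμ.mulL_mul, hμ.mulL_comm u v, hμ.mulL_mul]

variable [CompleteSpace H]

theorem inner_tmul_comul (u v w : H) :
    inner ℂ (tmul u v) (comul μ w) = inner ℂ (mulL μ u v) w :=
  ContinuousLinearMap.adjoint_inner_right μ _ _

theorem contraction_comul (u v : H) :
    contraction H H (comul μ v) u = adjoint (mulL μ u) v :=
  ext_inner_left ℂ fun w => by
    rw [contraction_apply, ContinuousLinearMap.adjoint_inner_right, tmulL_apply,
      inner_tmul_comul, ContinuousLinearMap.adjoint_inner_right]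

theorem IsFrobenius.comul_mulL (hμ : IsFrobenius μ) (u v : H) :
    comul μ (mulL μ u v) = tmap (mulL μ u) (.id ℂ H) (comul μ v) := by
  have htensor : (tmap μ (.id ℂ H) ∘L ((tassoc H H H).symm.toContinuousLinearEquiv :
      HTensor H (HTensor H H) →L[ℂ] HTensor (HTensor H H) H)) ∘L tmulL H (HTensor H H) u
      = tmap (mulL μ u) (.id ℂ H) := ext_tmul fun x y => by
    have : (tassoc H H H).symm (tmul u (tmul x y)) = tmul (tmul u x) y := by
      rw [LinearIsometryEquiv.symm_apply_eq, tassoc_tmul]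
    simp [this, tmap_tmul, tmulL_apply, mulL_apply]
  simpa [← htensor, tmap_tmul, tmulL_apply, mulL_apply] using
    DFunLike.congr_fun hμ.left (tmul u v)

theorem IsFrobenius.adjoint_mulL_mul (hμ : IsFrobenius μ) (u v w : H) :
    adjoint (mulL μ u) (mulL μ v w) = mulL μ (adjoint (mulL μ u) v) w := by
  have htensor : innerSL ℂ (tmul v w) ∘L tmap (mulL μ u) (.id ℂ H)
      = innerSL ℂ (tmul (adjoint (mulL μ u) v) w) := ext_tmul fun x y => by
    simp [tmap_tmul, inner_tmul, ContinuousLinearMap.adjoint_inner_left]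
  refine ext_inner_right ℂ fun z => ?_
  calc inner ℂ (adjoint (mulL μ u) (mulL μ v w)) z
      = inner ℂ (tmul v w) (comul μ (mulL μ u z)) := by
        rw [ContinuousLinearMap.adjoint_inner_left, inner_tmul_comul]
    _ = inner ℂ (tmul v w) (tmap (mulL μ u) (.id ℂ H) (comul μ z)) := by rw [hμ.comul_mulL]
    _ = inner ℂ (tmul (adjoint (mulL μ u) v) w) (comul μ z) :=
        DFunLike.congr_fun htensor (comul μ z)
    _ = inner ℂ (mulL μ (adjoint (mulL μ u) v) w) z := inner_tmul_comul _ _ _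

namespace IsHilbertianFrobenius

variable (hμ : IsHilbertianFrobenius μ)
include hμ

theorem adjoint_mulL_mulL (u v w : H) :
    adjoint (mulL μ u) (mulL μ v w) = mulL μ v (adjoint (mulL μ u) w) := by
  rw [hμ.mulL_comm v w, hμ.adjoint_mulL_mul, hμ.mulL_comm]

theorem isStarNormal_mulL (u : H) : IsStarNormal (mulL μ u) :=
  ⟨ContinuousLinearMap.ext fun w => hμ.adjoint_mulL_mulL u u w⟩

theorem adjoint_mulL_comp_mulL_eq_contraction_comp (v : H) :
    ⇑(adjoint (mulL μ v) ∘L mulL μ v) =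
      contraction H H (comul μ v) ∘ contraction H H (comul μ v) := by
  funext u
  refine ext_inner_left ℂ fun y => ?_
  rw [Function.comp_apply, contraction_comul, contraction_comul]
  calc inner ℂ y (adjoint (mulL μ v) (mulL μ v u))
      = inner ℂ (mulL μ y v) (mulL μ u v) := by
        rw [ContinuousLinearMap.adjoint_inner_right, hμ.mulL_comm v y, hμ.mulL_comm v u]
    _ = inner ℂ (mulL μ y (adjoint (mulL μ u) v)) v := by
        rw [← ContinuousLinearMap.adjoint_inner_left, hμ.adjoint_mulL_mulL]
    _ = inner ℂ y (adjoint (mulL μ (adjoint (mulL μ u) v)) v) := by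
        rw [ContinuousLinearMap.adjoint_inner_right, hμ.mulL_comm y]

theorem isCompactOperator_adjoint_mulL_comp_mulL (v : H) :
    IsCompactOperator (adjoint (mulL μ v) ∘L mulL μ v) := by
  rw [hμ.adjoint_mulL_comp_mulL_eq_contraction_comp v]
  exact (isCompactOperator_contraction _).clm_comp _

end IsHilbertianFrobenius

end Multiplication

section GroupLike

variable {H : Type*} [NormedAddCommGroup H] [InnerProductSpace ℂ H] [CompleteSpace H]
  {μ : HTensor H H →L[ℂ] H}

theorem mem_groupLike_iff {x : H} :
    x ∈ groupLike μ ↔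
      x ≠ 0 ∧ ∀ u v, inner ℂ x (mulL μ u v) = inner ℂ x u * inner ℂ x v := by
  refine and_congr_right fun _ => ⟨fun hx u v => ?_, fun h => ?_⟩
  · rw [← inner_tmul, ← hx, mulL_apply, comul, ContinuousLinearMap.adjoint_inner_left]
  · have htensor : innerSL ℂ (comul μ x) = innerSL ℂ (tmul x x) := ext_tmul fun u v => by
      rw [innerSL_apply_apply, innerSL_apply_apply, inner_tmul, ← h, mulL_apply, comul,
        ContinuousLinearMap.adjoint_inner_left]
    exact innerSL_inj.1 htensor

theorem adjoint_mulL_of_mem_groupLike {x : H} (hx : x ∈ groupLike μ) (u : H) :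
    adjoint (mulL μ u) x = inner ℂ u x • x :=
  ext_inner_right ℂ fun v => by
    rw [ContinuousLinearMap.adjoint_inner_left, (mem_groupLike_iff.1 hx).2, inner_smul_left,
      inner_conj_symm]

theorem norm_le_of_mem_groupLike {x : H} (hx : x ∈ groupLike μ) : ‖x‖ ≤ ‖μ‖ := by
  have h : ‖x‖ * ‖x‖ ≤ ‖μ‖ * ‖x‖ := by
    rw [← norm_tmul, ← hx.2, ← LinearIsometryEquiv.norm_map adjoint μ]
    exact (comul μ).le_opNorm x
  exact le_of_mul_le_mul_right h (norm_pos_iff.2 hx.1)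

theorem isMaximalModularIdeal_ker_of_mem_groupLike {x : H} (hx : x ∈ groupLike μ) :
    IsMaximalModularIdeal μ (innerSL ℂ x).ker := by
  have hxx : inner ℂ x x ≠ 0 := inner_self_ne_zero.2 hx.1
  have hmul := (mem_groupLike_iff.1 hx).2
  have hmem : ∀ u, u ∈ (innerSL ℂ x).ker ↔ inner ℂ x u = 0 := fun _ => Iff.rfl
  have hmodular : IsModular μ (innerSL ℂ x).ker := ⟨(inner ℂ x x)⁻¹ • x, fun u => by
    rw [hmem, inner_sub_right, ← mulL_apply, hmul, inner_smul_right, inv_mul_cancel₀ hxx, mul_one,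
      sub_self]⟩
  have hideal : IsLeftIdeal μ (innerSL ℂ x).ker := fun u v hv => by
    rw [hmem] at hv ⊢
    rw [← mulL_apply, hmul, hv, mul_zero]
  have hcoatom : IsCoatom (innerSL ℂ x).ker :=
    LinearMap.isCoatom_ker_of_surjective (LinearMap.surjective fun h =>
      hxx (DFunLike.congr_fun h x))
  exact ⟨hmodular, ⟨hideal, hcoatom.1⟩, fun I hI hle =>
    ((hcoatom.le_iff.1 hle).resolve_left hI.2).le⟩

theorem orthogonal_span_groupLike_mem_invtSubmodule_mulL (v : H) :
    (Submodule.span ℂ (groupLike μ))ᗮ ∈ Module.End.invtSubmodule (mulL μ v).toLinearMap :=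
  ContinuousLinearMap.orthogonal_mem_invtSubmodule <|
    span_mem_invtSubmodule_of_forall_eq_smul fun _ hx => ⟨_, adjoint_mulL_of_mem_groupLike hx v⟩

namespace IsHilbertianFrobenius

variable (hμ : IsHilbertianFrobenius μ)
include hμ

theorem mulL_of_mem_groupLike {x : H} (hx : x ∈ groupLike μ) (u : H) :
    mulL μ u x = inner ℂ x u • x := by
  rw [apply_eq_conj_smul_of_adjoint_apply_eq_smul (hμ.isStarNormal_mulL u)
    (adjoint_mulL_of_mem_groupLike hx u), inner_conj_symm]

theorem inner_eq_zero_of_mem_groupLike {x y : H} (hx : x ∈ groupLike μ)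
    (hy : y ∈ groupLike μ) (hxy : x ≠ y) : inner ℂ x y = 0 := by
  by_contra h
  refine hxy (ext_inner_right ℂ fun u => mul_left_cancel₀ h ?_)
  rw [← (mem_groupLike_iff.1 hx).2, hμ.mulL_comm, hμ.mulL_of_mem_groupLike hy, inner_smul_right,
    mul_comm]

end IsHilbertianFrobenius

theorem IsHilbertianAlgebra.mem_groupLike_of_forall_mulL_eq_smul (hμ : IsHilbertianAlgebra μ)
    {g x : H} (hg : g ≠ 0) (hx : x ≠ 0) (h : ∀ u, mulL μ u x = inner ℂ g u • x) :
    g ∈ groupLike μ :=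
  mem_groupLike_iff.2 ⟨hg, fun u v => smul_left_injective ℂ hx <|
    calc inner ℂ g (mulL μ u v) • x
        = mulL μ u (mulL μ v x) := by rw [← h, hμ.mulL_mul]
      _ = (inner ℂ g u * inner ℂ g v) • x := by
        rw [h, map_smul, h, smul_smul, mul_comm]⟩

namespace IsHilbertianFrobenius

variable (hμ : IsHilbertianFrobenius μ)
include hμ

theorem exists_groupLike_of_joint_eigenvector {x : H} (hx : x ≠ 0)
    {χ : H → ℂ} (hχ : ∀ u, mulL μ u x = χ u • x) {v : H} (hv : χ v ≠ 0) :
    ∃ g ∈ groupLike μ, inner ℂ g x ≠ 0 := by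
  have hxx : inner ℂ x x ≠ 0 := inner_self_ne_zero.2 hx
  let g : H := (inner ℂ x x)⁻¹ • adjoint (mulL μ x) x
  have hgχ : ∀ u, inner ℂ g u = χ u := fun u => by
    rw [inner_smul_left, ContinuousLinearMap.adjoint_inner_left, hμ.mulL_comm, hχ,
      inner_smul_right, map_inv₀, inner_conj_symm, mul_comm, mul_assoc, mul_inv_cancel₀ hxx,
      mul_one]
  have hg0 : g ≠ 0 := fun h => hv (by rw [← hgχ, h, inner_zero_left])
  have hg : g ∈ groupLike μ :=
    hμ.mem_groupLike_of_forall_mulL_eq_smul hg0 hx fun u => by rw [hgχ, hχ]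
  refine ⟨g, hg, fun hgx => smul_ne_zero (inner_self_ne_zero (𝕜 := ℂ).2 hg0) hx ?_⟩
  rw [hgχ, ← hχ, hμ.mulL_comm, hμ.mulL_of_mem_groupLike hg, hgx, zero_smul]

theorem orthogonal_span_groupLike_mem_invtSubmodule_adjoint_mulL (v : H) :
    (Submodule.span ℂ (groupLike μ))ᗮ ∈
      Module.End.invtSubmodule (adjoint (mulL μ v)).toLinearMap :=
  ContinuousLinearMap.orthogonal_mem_invtSubmodule <| by
    rw [ContinuousLinearMap.adjoint_adjoint]
    exact span_mem_invtSubmodule_of_forall_eq_smul fun _ hx => ⟨_, hμ.mulL_of_mem_groupLike hx v⟩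

theorem orthogonal_span_groupLike_mem_invtSubmodule_adjoint_mulL_comp_mulL (v : H) :
    (Submodule.span ℂ (groupLike μ))ᗮ ∈
      Module.End.invtSubmodule (adjoint (mulL μ v) ∘L mulL μ v).toLinearMap :=
  Module.End.invtSubmodule.comp _ (hμ.orthogonal_span_groupLike_mem_invtSubmodule_adjoint_mulL v)
    (orthogonal_span_groupLike_mem_invtSubmodule_mulL v)

theorem commute_adjoint_mulL_comp_mulL (v w : H) :
    Commute (adjoint (mulL μ v) ∘L mulL μ v).toLinearMap (mulL μ w).toLinearMap :=
  LinearMap.ext fun u =>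
    (congrArg (adjoint (mulL μ v)) (hμ.mulL_mulL_comm v w u)).trans
      (hμ.adjoint_mulL_mulL v w (mulL μ v u))

theorem mulL_eq_zero_of_mem_orthogonal_span_groupLike {u : H}
    (hu : u ∈ (Submodule.span ℂ (groupLike μ))ᗮ) (v : H) : mulL μ v u = 0 := by
  suffices hker : u ∈ (adjoint (mulL μ v) ∘L mulL μ v).ker by
    rwa [ContinuousLinearMap.ker_adjoint_comp_self] at hker
  by_contra hSu
  obtain ⟨x, hxK, hSx, hχ⟩ := exists_joint_eigenvector_of_isCompactOperator
    (hμ.isCompactOperator_adjoint_mulL_comp_mulL v)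
    (ContinuousLinearMap.isPositive_adjoint_comp_self _).isSymmetric
    (hμ.commute_adjoint_mulL_comp_mulL v) (fun w z => LinearMap.ext (hμ.mulL_mulL_comm w z))
    (hμ.orthogonal_span_groupLike_mem_invtSubmodule_adjoint_mulL_comp_mulL v)
    orthogonal_span_groupLike_mem_invtSubmodule_mulL hu hSu
  have hvx : mulL μ v x ≠ 0 := fun h => hSx (by simp [h])
  choose χ hχ using hχ
  have hχv : χ v ≠ 0 := fun h => hvx ((hχ v).trans (by rw [h, zero_smul]))
  have hx : x ≠ 0 := fun h => hSx (by rw [h, map_zero])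
  obtain ⟨g, hg, hgx⟩ := hμ.exists_groupLike_of_joint_eigenvector hx hχ hχv
  exact hgx (mem_orthogonal_span_iff.1 hxK g hg)

theorem jacobson_eq_orthogonal_span_groupLike :
    jacobson μ = (Submodule.span ℂ (groupLike μ))ᗮ := by
  refine le_antisymm (fun u hu => mem_orthogonal_span_iff.2 fun x hx => ?_)
    (fun u hu => Submodule.mem_sInf.2 fun I hI => ?_)
  · exact Submodule.mem_sInf.1 hu _ (isMaximalModularIdeal_ker_of_mem_groupLike hx)
  · obtain ⟨e, he⟩ := hI.1
    have hue : μ (tmul u e) = 0 := by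
      rw [← mulL_apply, hμ.mulL_comm, hμ.mulL_eq_zero_of_mem_orthogonal_span_groupLike hu]
    simpa [hue] using he u

theorem mulL_mem_orthogonal_jacobson (u v : H) : mulL μ u v ∈ (jacobson μ)ᗮ := by
  intro n hn
  rw [hμ.jacobson_eq_orthogonal_span_groupLike] at hn
  rw [← ContinuousLinearMap.adjoint_inner_left,
    (ContinuousLinearMap.IsStarNormal.adjoint_apply_eq_zero_iff (hμ.isStarNormal_mulL u) n).2
      (hμ.mulL_eq_zero_of_mem_orthogonal_span_groupLike hn u), inner_zero_left]

theorem isSubalgebra_orthogonal_jacobson : IsSubalgebra μ (jacobson μ)ᗮ := by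
  have hclosed := Submodule.isClosed_orthogonal (jacobson μ)
  exact ⟨hclosed, fun _ => mem_of_forall_tmul_mem (V := (jacobson μ)ᗮ.comap μ.toLinearMap)
    (hclosed.preimage μ.continuous) hμ.mulL_mem_orthogonal_jacobson _⟩

theorem groupLike_subset_orthogonal_jacobson : groupLike μ ⊆ (jacobson μ)ᗮ := by
  rw [hμ.jacobson_eq_orthogonal_span_groupLike]
  exact Submodule.subset_span.trans (Submodule.le_orthogonal_orthogonal _)

end IsHilbertianFrobenius

end GroupLike

section Weighted

variable {X E : Type*} [NormedAddCommGroup E] {w : Weight X} {b : X → E}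

theorem ne_zero_of_weight_eq (hw : ∀ x, w x = 1 / ‖b x‖ ^ 2) (x : X) : b x ≠ 0 := fun h => by
  simpa [hw, h] using w.pos x

variable [InnerProductSpace ℂ E] [CompleteSpace E]

/-- For a total family `b` of pairwise orthogonal vectors in a Hilbert space and the weight
`w x = 1 / ‖b x‖ ^ 2`, the unitary map onto `ℓ²_w(X)` sending `u` to the function `x ↦ ⟪b x, u⟫`.
It is the expansion in the Hilbert basis of the vectors `‖b x‖⁻¹ • b x`, with the factors `‖b x‖`
moved into the weight. -/
def innerEquivWL2 (hw : ∀ x, w x = 1 / ‖b x‖ ^ 2)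
    (horth : Pairwise fun x y => inner ℂ (b x) (b y) = 0)
    (htotal : (Submodule.span ℂ (Set.range b))ᗮ = ⊥) : E ≃ₗᵢ[ℂ] WL2 w :=
  (HilbertBasis.mkOfOrthogonalEqBot (orthonormal_inv_norm_smul (ne_zero_of_weight_eq hw) horth)
    ((orthogonal_span_range_inv_norm_smul (ne_zero_of_weight_eq hw)).trans htotal)).repr.trans
      (WL2.toLp w).symm

theorem innerEquivWL2_apply (hw : ∀ x, w x = 1 / ‖b x‖ ^ 2)
    (horth : Pairwise fun x y => inner ℂ (b x) (b y) = 0)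
    (htotal : (Submodule.span ℂ (Set.range b))ᗮ = ⊥) (u : E) (x : X) :
    innerEquivWL2 hw horth htotal u x = inner ℂ (b x) u := by
  have hsqrt : Real.sqrt (w x) = ‖b x‖⁻¹ := by
    rw [hw, one_div, Real.sqrt_inv, Real.sqrt_sq (norm_nonneg _)]
  have hb : (‖b x‖ : ℂ)⁻¹ ≠ 0 := by simpa using ne_zero_of_weight_eq hw x
  change (Real.sqrt (w x) : ℂ)⁻¹ * HilbertBasis.repr _ u x = inner ℂ (b x) u
  rw [HilbertBasis.repr_apply_apply, HilbertBasis.coe_mkOfOrthogonalEqBot, inner_smul_left,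
    map_inv₀, RCLike.conj_ofReal, hsqrt, Complex.ofReal_inv]
  exact inv_mul_cancel_left₀ hb _

end Weighted

section Representation

variable {H : Type*} [NormedAddCommGroup H] [InnerProductSpace ℂ H] {μ : HTensor H H →L[ℂ] H}

theorem restrict_tmul {V : Submodule ℂ H} (hV : IsSubalgebra μ V) (u v : V) :
    (restrict μ V hV (tmul u v) : H) = mulL μ u v :=
  congrArg μ (tmap_tmul _ _ u v)

theorem IsSemigroupHom.symm {K : Type*} [NormedAddCommGroup K] [InnerProductSpace ℂ K]
    {γ : HTensor K K →L[ℂ] K} {U : H ≃L[ℂ] K} (h : IsSemigroupHom μ γ (U : H →L[ℂ] K)) :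
    IsSemigroupHom γ μ (U.symm : K →L[ℂ] H) := by
  refine ext_tmul fun u v => U.injective ?_
  have hUsymm := DFunLike.congr_fun h (tmul (U.symm u) (U.symm v))
  simp only [ContinuousLinearMap.comp_apply, tmap_tmul, ContinuousLinearEquiv.coe_coe,
    ContinuousLinearEquiv.apply_symm_apply] at hUsymm ⊢
  exact hUsymm.symm

variable [CompleteSpace H]

theorem one_div_norm_sq_pos_of_mem_groupLike {x : H} (hx : x ∈ groupLike μ) :
    0 < 1 / ‖μ‖ ^ 2 := by
  have := (norm_pos_iff.2 hx.1).trans_le (norm_le_of_mem_groupLike hx)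
  positivity

theorem one_div_norm_sq_le_of_mem_groupLike {x : H} (hx : x ∈ groupLike μ) :
    1 / ‖μ‖ ^ 2 ≤ 1 / ‖x‖ ^ 2 := by
  have := norm_pos_iff.2 hx.1
  gcongr
  exact norm_le_of_mem_groupLike hx

/-- The weight `x ↦ 1 / ‖x‖ ^ 2` on the group-like elements, with lower bound `1 / ‖μ‖ ^ 2` as soon
as there is one. -/
def groupLikeWeight (μ : HTensor H H →L[ℂ] H) : Weight (groupLike μ) where
  toFun x := 1 / ‖(x : H)‖ ^ 2
  bounded_below := by
    obtain h | ⟨⟨x⟩⟩ := isEmpty_or_nonempty (groupLike μ)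
    · exact ⟨1, one_pos, h.elim⟩
    · exact ⟨1 / ‖μ‖ ^ 2, one_div_norm_sq_pos_of_mem_groupLike x.2,
        fun x => one_div_norm_sq_le_of_mem_groupLike x.2⟩

namespace IsHilbertianFrobenius

variable (hμ : IsHilbertianFrobenius μ)

/-- A group-like element, seen as a vector of the orthogonal complement of the Jacobson radical. -/
def groupLikeVector (x : groupLike μ) : (jacobson μ)ᗮ :=
  ⟨x, hμ.groupLike_subset_orthogonal_jacobson x.2⟩

theorem pairwise_inner_groupLikeVector_eq_zero :
    Pairwise fun x y => inner ℂ (hμ.groupLikeVector x) (hμ.groupLikeVector y) = 0 :=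
  fun x y hxy => hμ.inner_eq_zero_of_mem_groupLike x.2 y.2 fun h => hxy (Subtype.ext h)

theorem orthogonal_span_range_groupLikeVector :
    (Submodule.span ℂ (Set.range hμ.groupLikeVector))ᗮ = ⊥ := by
  refine (Submodule.eq_bot_iff _).2 fun u hu => ?_
  have hJ : (u : H) ∈ jacobson μ :=
    hμ.jacobson_eq_orthogonal_span_groupLike.ge <| mem_orthogonal_span_iff.2 fun x hx =>
      mem_orthogonal_span_iff.1 hu _ (Set.mem_range_self (⟨x, hx⟩ : groupLike μ))
  exact Subtype.ext (inner_self_eq_zero.1 (u.2 u hJ))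

/-- The Gelfand transform `u ↦ (x ↦ ⟪x, u⟫)` as a unitary map from `J^⊥` onto `ℓ²_w(G)`: the
characters of the algebra are the functionals `⟪x, ·⟫` represented by group-like `x`. -/
def gelfand : (jacobson μ)ᗮ ≃ₗᵢ[ℂ] WL2 (groupLikeWeight μ) :=
  innerEquivWL2 (fun _ => rfl) hμ.pairwise_inner_groupLikeVector_eq_zero
    hμ.orthogonal_span_range_groupLikeVector

theorem gelfand_apply (u : (jacobson μ)ᗮ) (x : groupLike μ) :
    hμ.gelfand u x = inner ℂ (x : H) (u : H) :=
  innerEquivWL2_apply _ _ _ u x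

theorem isSemigroupHom_gelfand (hJ : IsSubalgebra μ (jacobson μ)ᗮ) :
    IsSemigroupHom (restrict μ (jacobson μ)ᗮ hJ) (WL2.mul (groupLikeWeight μ))
      (hμ.gelfand.toContinuousLinearEquiv : (jacobson μ)ᗮ →L[ℂ] WL2 (groupLikeWeight μ)) := by
  refine ext_tmul fun u v => WL2.ext fun x => ?_
  rw [ContinuousLinearMap.comp_apply, ContinuousLinearMap.comp_apply, tmap_tmul, WL2.mul_tmul]
  change hμ.gelfand (restrict μ _ hJ (tmul u v)) x = hμ.gelfand u x * hμ.gelfand v x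
  simp only [gelfand_apply, restrict_tmul, (mem_groupLike_iff.1 x.2).2]

include hμ in
theorem unitarilyIsomorphic_restrict_orthogonal_jacobson (hJ : IsSubalgebra μ (jacobson μ)ᗮ) :
    UnitarilyIsomorphic (restrict μ (jacobson μ)ᗮ hJ) (WL2.mul (groupLikeWeight μ)) :=
  ⟨hμ.gelfand, hμ.isSemigroupHom_gelfand hJ, (hμ.isSemigroupHom_gelfand hJ).symm⟩

end IsHilbertianFrobenius

end Representation

end HilbFrob
end

theorem mainTheorem7 {H : Type*} [NormedAddCommGroup H] [InnerProductSpace ℂ H] [CompleteSpace H]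
    (μ : HilbFrob.HTensor H H →L[ℂ] H) (hμ : HilbFrob.IsHilbertianFrobenius μ) :
    ∃ (hJ : HilbFrob.IsSubalgebra μ (HilbFrob.jacobson μ)ᗮ)
      (w : HilbFrob.Weight (HilbFrob.groupLike μ)),
      (∀ x : HilbFrob.groupLike μ, w x = 1 / ‖(x : H)‖ ^ 2) ∧
      (∀ x : HilbFrob.groupLike μ, 0 < 1 / ‖μ‖ ^ 2 ∧ 1 / ‖μ‖ ^ 2 ≤ w x) ∧
      HilbFrob.UnitarilyIsomorphic
        (HilbFrob.restrict μ (HilbFrob.jacobson μ)ᗮ hJ) (HilbFrob.WL2.mul w) := by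
  have hJ := hμ.isSubalgebra_orthogonal_jacobson
  refine ⟨hJ, HilbFrob.groupLikeWeight μ, fun _ => rfl, fun x => ⟨?_, ?_⟩, ?_⟩
  · exact HilbFrob.one_div_norm_sq_pos_of_mem_groupLike x.2
  · exact HilbFrob.one_div_norm_sq_le_of_mem_groupLike x.2
  · exact hμ.unitarilyIsomorphic_restrict_orthogonal_jacobson hJ
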